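/- Let $R$ be a commutative ring. A functor of $\mathcal R$-modules is a covariant functor $\mathbb M$ from the category of commutative $R$-algebras to sets such that each $\mathbb M(S)$ is an $S$-module, with addition $\mathbb M\times\mathbb M\to\mathbb M$ and scalar multiplication $\mathcal R\times\mathbb M\to\mathbb M$ functorial, where $\mathcal R(S):=S$. Limits, colimits, images and intersections are computed objectwise. The dual is $\mathbb M^*(S):=\operatorname{Hom}_{\mathcal S}(\mathbb M_{|S},\mathcal R_{|S})$, where $_{|S}$ denotes restriction to commutative $S$-algebras, and $\mathbb M$ is reflexive if the canonical morphism $\mathbb M\to\mathbb M^{**}$ is an isomorphism. For a set $\alpha$ put $\mathcal R^{\alpha}:=\prod_\alpha\mathcal R$ and $\mathcal R^{(\alpha)}:=\bigoplus_\alpha\mathcal R$; for $\alpha_1\subseteq\alpha_2$ there are the projection $\mathcal R^{(\alpha_2)}\to\mathcal R^{(\alpha_1)}$ and the extension by zero $\mathcal R^{\alpha_1}\to\mathcal R^{\alpha_2}$. Let $I$ be a set and let $P$ be a set of subsets of $I$ such that $\alpha\cup\alpha'\in P$ for all $\alpha,\alpha'\in P$ and $\bigcup_{\alpha\in P}\alpha=I$.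 For a set $Q$ of subsets of $I$ put $Q^\circ:=\{\beta\subseteq I:\ \beta\cap\alpha\text{ is finite for all }\alpha\in Q\}$; sets of subsets of $I$ are ordered by inclusion. Then: 1. The canonical morphisms $\varprojlim_{\alpha\in P}\mathcal R^{(\alpha)}\to\mathcal R^I$ (the morphism sending $x=(x_\alpha)_{\alpha\in P}$ to the family whose $i$-th entry is $(x_\alpha)_i$ for every $\alpha\in P$ with $i\in\alpha$) and $\varinjlim_{\beta\in P^\circ}\mathcal R^{\beta}\to\mathcal R^I$ (extension by zero) are well defined and injective, and they have the same image, so that there is an isomorphism $\varinjlim_{\beta\in P^\circ}\mathcal R^{\beta}\simeq\varprojlim_{\alpha\in P}\mathcal R^{(\alpha)}$ compatible with them. This image is $$\bigcap_{\alpha\in P}\bigl(\mathcal R^{(\alpha)}\times\mathcal R^{I-\alpha}\bigr)\subseteq\mathcal R^I .$$ 2. There is an isomorphism of functors of $\mathcal R$-modules $$\Bigl(\varprojlim_{\alpha\in P}\mathcal R^{(\alpha)}\Bigr)^{*}\simeq\varprojlim_{\beta\in P^\circ}\mathcal R^{(\beta)},\qquad \varphi\mapsto (w_\beta)_{\beta\in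 P^\circ},$$ such that for every $\varphi$ over $S$, every commutative $S$-algebra $T$, every $x$ in the $T$-points of $\varprojlim_{\alpha\in P}\mathcal R^{(\alpha)}$, with image $(x_i)\in T^I$, and every $\beta\in P^\circ$ with $\{i: x_i\neq0\}\subseteq\beta$ one has $\varphi(x)=\sum_{i\in\beta}(w_\beta)_i\,x_i$. Moreover $\varprojlim_{\alpha\in P}\mathcal R^{(\alpha)}$ is reflexive, and $P\subseteq P^{\circ\circ}$ induces an isomorphism $$\varprojlim_{\alpha\in P^{\circ\circ}}\mathcal R^{(\alpha)}\xrightarrow{\ \sim\ }\varprojlim_{\alpha\in P}\mathcal R^{(\alpha)} .$$ -/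

import Mathlib

open CategoryTheory

universe u w w' w''

noncomputable section

/-- A functor of `𝓡`-modules: a covariant functor `M` on the category of commutative `R`-algebras
such that every `M(S)` is an `S`-module, with the addition `M × M → M` and the multiplication by
scalars `𝓡 × M → M` functorial in `S`, where `𝓡(S) = S`. -/
structure ModFunctor (R : Type u) [CommRing R] where
  obj : CommAlgCat.{u} R → Type w
  [addCommGroup : ∀ S : CommAlgCat.{u} R, AddCommGroup (obj S)]
  [module : ∀ S : CommAlgCat.{u} R, Module S (obj S)]
  map : ∀ {S T : CommAlgCat.{u} R}, (S ⟶ T) → obj S →+ obj T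
  map_smul : ∀ {S T : CommAlgCat.{u} R} (g : S ⟶ T) (s : S) (m : obj S),
    map g (s • m) = g.hom s • map g m
  map_id : ∀ (S : CommAlgCat.{u} R) (m : obj S), map (𝟙 S) m = m
  map_comp : ∀ {S T U : CommAlgCat.{u} R} (g : S ⟶ T) (h : T ⟶ U) (m : obj S),
    map (g ≫ h) m = map h (map g m)

namespace ModFunctor

variable {R : Type u} [CommRing R]

instance instAddCommGroupObj (M : ModFunctor.{u, w} R) (S : CommAlgCat.{u} R) :
    AddCommGroup (M.obj S) := M.addCommGroup S

instance instModuleObj (M : ModFunctor.{u, w} R) (S : CommAlgCat.{u} R) :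
    Module S (M.obj S) := M.module S

/-- A morphism of functors of `𝓡`-modules. -/
structure Hom (M : ModFunctor.{u, w} R) (N : ModFunctor.{u, w'} R) where
  app : ∀ S : CommAlgCat.{u} R, M.obj S →ₗ[S] N.obj S
  naturality : ∀ {S T : CommAlgCat.{u} R} (g : S ⟶ T) (m : M.obj S),
    N.map g (app S m) = app T (M.map g m)

/-- A morphism of functors of `𝓡`-modules is a monomorphism if all its components are injective. -/
def Hom.IsInjective {M : ModFunctor.{u, w} R} {N : ModFunctor.{u, w'} R} (f : Hom M N) : Prop :=
  ∀ S, Function.Injective (f.app S)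

/-- A morphism of functors of `𝓡`-modules is an isomorphism if all its components are bijective
(the componentwise inverses are then linear and natural). -/
def Hom.IsIso {M : ModFunctor.{u, w} R} {N : ModFunctor.{u, w'} R} (f : Hom M N) : Prop :=
  ∀ S, Function.Bijective (f.app S)

/-- Composition (`f` first, then `g`). -/
def Hom.comp {M : ModFunctor.{u, w} R} {N : ModFunctor.{u, w'} R} {L : ModFunctor.{u, w''} R}
    (f : Hom M N) (g : Hom N L) : Hom M L where
  app S := (g.app S).comp (f.app S)
  naturality h m := by simp [g.naturality, f.naturality]

/-- A functor of `𝓡`-submodules of `M`. -/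
@[ext]
structure Subfunctor (M : ModFunctor.{u, w} R) where
  carrier : ∀ S : CommAlgCat.{u} R, Submodule S (M.obj S)
  map_mem : ∀ {S T : CommAlgCat.{u} R} (g : S ⟶ T) (m : M.obj S),
    m ∈ carrier S → M.map g m ∈ carrier T

/-- The image of a morphism, `(Im f)(S) = Im f_S`. -/
def Hom.range {M : ModFunctor.{u, w} R} {N : ModFunctor.{u, w'} R} (f : Hom M N) : Subfunctor N where
  carrier S := LinearMap.range (f.app S)
  map_mem := by
    rintro S T g _ ⟨m, rfl⟩
    exact ⟨M.map g m, (f.naturality g m).symm⟩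

/-- The intersection of a family of functors of submodules. -/
def Subfunctor.iInter {ι : Type*} {M : ModFunctor.{u, w} R} (N : ι → Subfunctor M) : Subfunctor M where
  carrier S := ⨅ i, (N i).carrier S
  map_mem g m hm := by
    simp only [Submodule.mem_iInf] at hm ⊢
    exact fun i => (N i).map_mem g m (hm i)

/-- The functor `𝓡`, `𝓡(S) = S`. -/
def base (R : Type u) [CommRing R] : ModFunctor.{u, u} R where
  obj S := S
  addCommGroup _ := inferInstance
  module _ := inferInstance
  map g := (g.hom : _ →+ _)
  map_smul g s m := by simp
  map_id S m := by simp
  map_comp g h m := by simp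

/-! ### Internal homomorphisms, duals, reflexivity -/

/-- `Hom_𝓢(M_{|S}, N_{|S})`, the morphisms between the restrictions of `M` and `N` to the
commutative `S`-algebras. A commutative `S`-algebra is given as a commutative `R`-algebra `T` with
a morphism of `R`-algebras `j : S ⟶ T`; a morphism of `S`-algebras from `(T, j)` to another one is
a morphism `g : T ⟶ T'` of `R`-algebras, the target being `(T', j ≫ g)`. -/
def homOver (M : ModFunctor.{u, w} R) (N : ModFunctor.{u, w'} R) (S : CommAlgCat.{u} R) :
    AddSubgroup (∀ T : CommAlgCat.{u} R, (S ⟶ T) → (M.obj T →ₗ[T] N.obj T)) where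
  carrier := {φ | ∀ (T T' : CommAlgCat.{u} R) (j : S ⟶ T) (g : T ⟶ T') (m : M.obj T),
    N.map g (φ T j m) = φ T' (j ≫ g) (M.map g m)}
  zero_mem' T T' j g m := by simp
  add_mem' hφ hψ T T' j g m := by simp [hφ T T' j g m, hψ T T' j g m]
  neg_mem' hφ T T' j g m := by simp [hφ T T' j g m]

/-- The `S`-module structure on `Hom_𝓢(M_{|S}, N_{|S})`. -/
instance homOverModule (M : ModFunctor.{u, w} R) (N : ModFunctor.{u, w'} R)
    (S : CommAlgCat.{u} R) : Module S (homOver M N S) where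
  smul s φ := ⟨fun T j => j.hom s • φ.1 T j, fun T T' j g m => by
    simp [N.map_smul, φ.2 T T' j g m]⟩
  one_smul φ := by
    refine Subtype.ext (funext fun T => funext fun j => LinearMap.ext fun m => ?_)
    change j.hom 1 • φ.1 T j m = φ.1 T j m
    simp
  mul_smul s t φ := by
    refine Subtype.ext (funext fun T => funext fun j => LinearMap.ext fun m => ?_)
    change j.hom (s * t) • φ.1 T j m = j.hom s • j.hom t • φ.1 T j m
    simp [mul_smul]
  smul_zero s := by
    refine Subtype.ext (funext fun T => funext fun j => LinearMap.ext fun m => ?_)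
    change j.hom s • (0 : N.obj T) = 0
    simp
  smul_add s φ ψ := by
    refine Subtype.ext (funext fun T => funext fun j => LinearMap.ext fun m => ?_)
    change j.hom s • (φ.1 T j m + ψ.1 T j m) = j.hom s • φ.1 T j m + j.hom s • ψ.1 T j m
    simp
  add_smul s t φ := by
    refine Subtype.ext (funext fun T => funext fun j => LinearMap.ext fun m => ?_)
    change j.hom (s + t) • φ.1 T j m = j.hom s • φ.1 T j m + j.hom t • φ.1 T j m
    simp [add_smul]
  zero_smul φ := by
    refine Subtype.ext (funext fun T => funext fun j => LinearMap.ext fun m => ?_)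
    change j.hom 0 • φ.1 T j m = 0
    simp

/-- The functor of `𝓡`-modules `S ↦ Hom_𝓢(M_{|S}, N_{|S})`. -/
def internalHom (M : ModFunctor.{u, w} R) (N : ModFunctor.{u, w'} R) :
    ModFunctor.{u, max (u + 1) w w'} R where
  obj S := homOver M N S
  addCommGroup _ := inferInstance
  module S := homOverModule M N S
  map g :=
    { toFun φ := ⟨fun T j => φ.1 T (g ≫ j), fun T T' j h m => by
        simpa using φ.2 T T' (g ≫ j) h m⟩
      map_zero' := rfl
      map_add' _ _ := rfl }
  map_smul g s φ := by
    refine Subtype.ext (funext fun T => funext fun j => LinearMap.ext fun m => ?_)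
    change (g ≫ j).hom s • φ.1 T (g ≫ j) m = j.hom (g.hom s) • φ.1 T (g ≫ j) m
    simp
  map_id S φ := by
    refine Subtype.ext (funext fun T => funext fun j => ?_)
    change φ.1 T (𝟙 S ≫ j) = φ.1 T j
    rw [Category.id_comp]
  map_comp g h φ := by
    refine Subtype.ext (funext fun T => funext fun j => ?_)
    change φ.1 T ((g ≫ h) ≫ j) = φ.1 T (g ≫ h ≫ j)
    rw [Category.assoc]

/-- The dual `M^* = 𝓗om_𝓡(M, 𝓡)`. -/
def dual (M : ModFunctor.{u, w} R) : ModFunctor.{u, max (u + 1) w} R :=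
  internalHom M (base R)

/-- The value `φ_T(m) ∈ T` of `φ ∈ M^*(S)` at `m ∈ M(T)`, for the `S`-algebra `j : S ⟶ T`. -/
def dualApply (M : ModFunctor.{u, w} R) {S T : CommAlgCat.{u} R} (φ : M.dual.obj S) (j : S ⟶ T)
    (m : M.obj T) : T :=
  (φ : homOver M (base R) S).1 T j m

/-- The canonical morphism `M → M^{**}`, `m ↦ (φ ↦ φ(m))`. -/
def bidualHom (M : ModFunctor.{u, w} R) : Hom M M.dual.dual where
  app S :=
    { toFun m := ⟨fun T j =>
        { toFun φ := M.dualApply φ (𝟙 T) (M.map j m)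
          map_add' _ _ := rfl
          map_smul' t φ := by
            change (𝟙 T : T ⟶ T).hom t • M.dualApply φ (𝟙 T) (M.map j m) = _
            rw [CommAlgCat.hom_id]; rfl },
        fun T T' j g φ => by
          have h := (φ : homOver M (base R) T).2 T T' (𝟙 T) g (M.map j m)
          change (base R).map g ((φ : homOver M (base R) T).1 T (𝟙 T) (M.map j m))
            = (φ : homOver M (base R) T).1 T' (g ≫ 𝟙 T') (M.map (j ≫ g) m)
          rw [h, M.map_comp, Category.id_comp, Category.comp_id]⟩
      map_add' m m' := by
        refine Subtype.ext (funext fun T => funext fun j => LinearMap.ext fun φ => ?_)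
        change (φ : homOver M (base R) T).1 T (𝟙 T) (M.map j (m + m'))
          = (φ : homOver M (base R) T).1 T (𝟙 T) (M.map j m)
            + (φ : homOver M (base R) T).1 T (𝟙 T) (M.map j m')
        rw [map_add, map_add]
      map_smul' s m := by
        refine Subtype.ext (funext fun T => funext fun j => LinearMap.ext fun φ => ?_)
        change (φ : homOver M (base R) T).1 T (𝟙 T) (M.map j (s • m))
          = j.hom s • (φ : homOver M (base R) T).1 T (𝟙 T) (M.map j m)
        rw [M.map_smul, _root_.map_smul] }
  naturality {S T} g m := by
    refine Subtype.ext (funext fun U => funext fun j => LinearMap.ext fun φ => ?_)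
    change (φ : homOver M (base R) U).1 U (𝟙 U) (M.map (g ≫ j) m)
      = (φ : homOver M (base R) U).1 U (𝟙 U) (M.map j (M.map g m))
    rw [M.map_comp]

/-- `M` is reflexive if the canonical morphism `M → M^{**}` is an isomorphism. -/
def IsReflexive (M : ModFunctor.{u, w} R) : Prop := M.bidualHom.IsIso

/-! ### Limits and colimits, computed objectwise -/

/-- The binary product `M × N`. -/
def prod (M : ModFunctor.{u, w} R) (N : ModFunctor.{u, w'} R) : ModFunctor.{u, max w w'} R where
  obj S := M.obj S × N.obj S
  addCommGroup _ := inferInstance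
  module _ := inferInstance
  map g := (M.map g).prodMap (N.map g)
  map_smul g s m := by ext <;> simp [M.map_smul, N.map_smul]
  map_id S m := by ext <;> simp [M.map_id, N.map_id]
  map_comp g h m := by ext <;> simp [M.map_comp, N.map_comp]

/-- The morphism `M × N → L`, `(m, n) ↦ f(m) + g(n)`. -/
def Hom.coprod {M : ModFunctor.{u, w} R} {N : ModFunctor.{u, w'} R} {L : ModFunctor.{u, w''} R}
    (f : Hom M L) (g : Hom N L) : Hom (M.prod N) L where
  app S := LinearMap.coprod (f.app S) (g.app S)
  naturality {S T} h x := by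
    change L.map h (f.app S x.1 + g.app S x.2) = f.app T (M.map h x.1) + g.app T (N.map h x.2)
    rw [map_add, f.naturality, g.naturality]

section Limits

variable {ι : Type w'} [Preorder ι]

/-- The `S`-module of compatible families of an inverse system. -/
def invLimObj (F : ι → ModFunctor.{u, w} R) (f : ∀ i j, i ≤ j → Hom (F j) (F i))
    (S : CommAlgCat.{u} R) : Submodule S (∀ i, (F i).obj S) where
  carrier := {x | ∀ i j (h : i ≤ j), (f i j h).app S (x j) = x i}
  zero_mem' i j h := by simp
  add_mem' hx hy i j h := by simp [hx i j h, hy i j h]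
  smul_mem' s x hx i j h := by simp [hx i j h]

/-- The inverse limit of an inverse system of functors of `𝓡`-modules,
`(lim F)(S) = lim (F_i(S))`. -/
def invLim (F : ι → ModFunctor.{u, w} R) (f : ∀ i j, i ≤ j → Hom (F j) (F i)) :
    ModFunctor.{u, max w w'} R where
  obj S := invLimObj F f S
  addCommGroup _ := inferInstance
  module _ := inferInstance
  map g :=
    { toFun x := ⟨fun i => (F i).map g (x.1 i), fun i j h => by
        rw [← (f i j h).naturality, x.2 i j h]⟩
      map_zero' := by ext; simp
      map_add' _ _ := by ext; simp }
  map_smul g s x := Subtype.ext (funext fun i => (F i).map_smul g s (x.1 i))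
  map_id S x := Subtype.ext (funext fun i => (F i).map_id S (x.1 i))
  map_comp g h x := Subtype.ext (funext fun i => (F i).map_comp g h (x.1 i))

/-- The projections of the inverse limit. -/
def invLimProj (F : ι → ModFunctor.{u, w} R) (f : ∀ i j, i ≤ j → Hom (F j) (F i)) (i : ι) :
    Hom (invLim F f) (F i) where
  app S :=
    { toFun x := (x : invLimObj F f S).1 i
      map_add' _ _ := rfl
      map_smul' _ _ := rfl }
  naturality _ _ := rfl

open Classical in
/-- The `S`-module `colim F_i(S)` of a direct system. -/
abbrev dirLimObj (F : ι → ModFunctor.{u, w} R) (f : ∀ i j, i ≤ j → Hom (F i) (F j))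
    (S : CommAlgCat.{u} R) : Type (max w w') :=
  Module.DirectLimit (fun i => (F i).obj S) (fun i j h => (f i j h).app S)

open Classical in
/-- The canonical map `F_i(S) → colim F_i(S)`. -/
abbrev dirLimOf (F : ι → ModFunctor.{u, w} R) (f : ∀ i j, i ≤ j → Hom (F i) (F j))
    (S : CommAlgCat.{u} R) (i : ι) : (F i).obj S →ₗ[S] dirLimObj F f S :=
  Module.DirectLimit.of S ι (fun i => (F i).obj S) (fun i j h => (f i j h).app S) i

theorem dirLim_addHom_ext (F : ι → ModFunctor.{u, w} R) (f : ∀ i j, i ≤ j → Hom (F i) (F j))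
    (S : CommAlgCat.{u} R) {A : Type*} [AddCommMonoid A] {p q : dirLimObj F f S →+ A}
    (h : ∀ i (x : (F i).obj S), p (dirLimOf F f S i x) = q (dirLimOf F f S i x)) : p = q := by
  classical
  exact AddCon.hom_ext (DirectSum.addHom_ext fun i x => h i x)

open Classical in
/-- The map `colim F_i(S) → colim F_i(T)` induced by a morphism `g : S ⟶ T`. -/
def dirLimMap (F : ι → ModFunctor.{u, w} R) (f : ∀ i j, i ≤ j → Hom (F i) (F j))
    {S T : CommAlgCat.{u} R} (g : S ⟶ T) : dirLimObj F f S →+ dirLimObj F f T :=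
  letI : Module S (dirLimObj F f T) := Module.compHom _ g.hom.toRingHom
  (Module.DirectLimit.lift S ι (fun i => (F i).obj S) (fun i j h => (f i j h).app S)
    (fun i =>
      ({ toFun := fun x => dirLimOf F f T i ((F i).map g x)
         map_add' := fun x y => by simp
         map_smul' := fun s x => by
          rw [(F i).map_smul, _root_.map_smul]; rfl } : (F i).obj S →ₗ[S] dirLimObj F f T))
    (fun i j h x => by
      change dirLimOf F f T j ((F j).map g ((f i j h).app S x)) = dirLimOf F f T i ((F i).map g x)
      rw [(f i j h).naturality]
      exact Module.DirectLimit.of_f)).toAddMonoidHom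

theorem dirLimMap_of (F : ι → ModFunctor.{u, w} R) (f : ∀ i j, i ≤ j → Hom (F i) (F j))
    {S T : CommAlgCat.{u} R} (g : S ⟶ T) (i : ι) (x : (F i).obj S) :
    dirLimMap F f g (dirLimOf F f S i x) = dirLimOf F f T i ((F i).map g x) := by
  classical
  exact DirectSum.toAddMonoid_of (fun i => (dirLimOf F f T i).toAddMonoidHom.comp ((F i).map g)) i x

/-- The direct limit of a direct system of functors of `𝓡`-modules,
`(colim F)(S) = colim (F_i(S))`. -/
def dirLim (F : ι → ModFunctor.{u, w} R) (f : ∀ i j, i ≤ j → Hom (F i) (F j)) :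
    ModFunctor.{u, max w w'} R where
  obj S := dirLimObj F f S
  addCommGroup _ := inferInstance
  module _ := inferInstance
  map g := dirLimMap F f g
  map_smul {S T} g s x := by
    refine DFunLike.congr_fun (dirLim_addHom_ext F f S
      (p := (dirLimMap F f g).comp (DistribSMul.toAddMonoidHom _ s))
      (q := (DistribSMul.toAddMonoidHom _ (g.hom s)).comp (dirLimMap F f g)) fun i y => ?_) x
    change dirLimMap F f g (s • dirLimOf F f S i y) = g.hom s • dirLimMap F f g (dirLimOf F f S i y)
    rw [← _root_.map_smul, dirLimMap_of, dirLimMap_of, (F i).map_smul, _root_.map_smul]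
  map_id S x := by
    refine DFunLike.congr_fun (dirLim_addHom_ext F f S
      (p := dirLimMap F f (𝟙 S)) (q := AddMonoidHom.id _) fun i y => ?_) x
    rw [dirLimMap_of, (F i).map_id]; rfl
  map_comp {S T U} g h x := by
    refine DFunLike.congr_fun (dirLim_addHom_ext F f S
      (p := dirLimMap F f (g ≫ h)) (q := (dirLimMap F f h).comp (dirLimMap F f g))
      fun i y => ?_) x
    change _ = dirLimMap F f h (dirLimMap F f g (dirLimOf F f S i y))
    rw [dirLimMap_of, dirLimMap_of, dirLimMap_of, (F i).map_comp]

/-- The canonical morphisms into the direct limit. -/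
def dirLimIncl (F : ι → ModFunctor.{u, w} R) (f : ∀ i j, i ≤ j → Hom (F i) (F j)) (i : ι) :
    Hom (F i) (dirLim F f) where
  app S := dirLimOf F f S i
  naturality g x := dirLimMap_of F f g i x

end Limits

/-! ### The functors `𝓡^α` and `𝓡^(α)` -/

variable (R)

/-- The product `𝓡^α = ∏_α 𝓡`, for a set `α`. -/
def pow (α : Type u) : ModFunctor.{u, u} R where
  obj S := α → S
  addCommGroup _ := inferInstance
  module _ := inferInstance
  map g := (g.hom : _ →+ _).compLeft α
  map_smul g s x := by ext i; simp
  map_id S x := by ext i; simp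
  map_comp g h x := by ext i; simp

/-- The direct sum `𝓡^(α) = ⊕_α 𝓡`, for a set `α`. -/
def sum (α : Type u) : ModFunctor.{u, u} R where
  obj S := α →₀ S
  addCommGroup _ := inferInstance
  module _ := inferInstance
  map g := Finsupp.mapRange.addMonoidHom (g.hom : _ →+ _)
  map_smul g s x := by ext i; simp
  map_id S x := by ext i; simp
  map_comp g h x := by ext i; simp

variable {R} in
/-- An element of `𝓡^α(S)` as a family of elements of `S`. -/
def powCoe {α : Type u} {S : CommAlgCat.{u} R} (x : (pow R α).obj S) : α → S := x

variable {R} in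
/-- An element of `𝓡^(α)(S)` as a finitely supported family of elements of `S`. -/
def sumCoe {α : Type u} {S : CommAlgCat.{u} R} (x : (sum R α).obj S) : α →₀ S := x

variable {I : Type u}

/-- The projection `𝓡^(β) → 𝓡^(α)`, `(λ_i)_{i ∈ β} ↦ (λ_i)_{i ∈ α}`, for `α ⊆ β`. -/
def sumRestrict {α β : Set I} (h : α ⊆ β) : Hom (sum R β) (sum R α) where
  app S := Finsupp.lcomapDomain (Set.inclusion h) (Set.inclusion_injective h)
  naturality {S T} g x := by
    refine Finsupp.ext fun i => ?_
    rfl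

/-- The inclusion `𝓡^(α) → 𝓡^α`. -/
def sumToPow (α : Type u) : Hom (sum R α) (pow R α) where
  app _ := Finsupp.lcoeFun
  naturality _ _ := rfl

/-- The injection `𝓡^α → 𝓡^β` along an injective map `e : α → β`, extension by zero outside of the
image of `e`. -/
def powExtend {α β : Type u} (e : α → β) (he : Function.Injective e) :
    Hom (pow R α) (pow R β) where
  app S := Function.ExtendByZero.linearMap S e
  naturality {S T} g x := by
    refine funext fun i => ?_
    have key : ∀ y : α → S, g.hom (Function.extend e y 0 i)
        = Function.extend e (fun a => g.hom (y a)) 0 i := by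
      intro y
      by_cases h : ∃ a, e a = i
      · obtain ⟨a, rfl⟩ := h
        rw [he.extend_apply, he.extend_apply]
      · rw [Function.extend_apply' _ _ _ h, Function.extend_apply' _ _ _ h]
        simp
    exact key x

/-- The inclusion `𝓡^(α) × 𝓡^{I-α} → 𝓡^α × 𝓡^{I-α} = 𝓡^I`, for `α ⊆ I`. -/
def mixedIncl (α : Set I) : Hom ((sum R α).prod (pow R ↥αᶜ)) (pow R I) :=
  Hom.coprod
    ((sumToPow R α).comp (powExtend R (Subtype.val : α → I) Subtype.val_injective))
    (powExtend R (Subtype.val : ↥αᶜ → I) Subtype.val_injective)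

/-- The inverse limit `lim_{α ∈ P} 𝓡^(α)`, where `P` is ordered by inclusion and the transition
morphisms are the projections. -/
def limSum (P : Set (Set I)) : ModFunctor.{u, u} R :=
  invLim (fun α : P => sum R α.1) (fun _ _ h => sumRestrict R h)

/-- The projection `lim_{α ∈ P} 𝓡^(α) → 𝓡^(α)`. -/
def limSumProj (P : Set (Set I)) (α : P) : Hom (limSum R P) (sum R α.1) :=
  invLimProj (fun α : P => sum R α.1) (fun _ _ h => sumRestrict R h) α

/-- The direct limit `colim_{β ∈ Q} 𝓡^β`, where `Q` is ordered by inclusion and the transition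
morphisms are the extensions by zero. -/
def colimPow (Q : Set (Set I)) : ModFunctor.{u, u} R :=
  dirLim (fun β : Q => pow R β.1)
    (fun _ _ h => powExtend R (Set.inclusion h) (Set.inclusion_injective h))

/-- The canonical morphism `𝓡^β → colim_{β ∈ Q} 𝓡^β`. -/
def colimPowIncl (Q : Set (Set I)) (β : Q) : Hom (pow R β.1) (colimPow R Q) :=
  dirLimIncl (fun β : Q => pow R β.1)
    (fun _ _ h => powExtend R (Set.inclusion h) (Set.inclusion_injective h)) β

/-- The projection `lim_{α ∈ Q} 𝓡^(α) → lim_{α ∈ P} 𝓡^(α)`, for `P ⊆ Q`, that forgets the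
components outside of `P`. -/
def limSumRestrict {P Q : Set (Set I)} (h : P ⊆ Q) : Hom (limSum R Q) (limSum R P) where
  app S :=
    { toFun := fun x => ⟨fun α => (limSumProj R Q ⟨α.1, h α.2⟩).app S x,
        fun α β hαβ => x.2 ⟨α.1, h α.2⟩ ⟨β.1, h β.2⟩ hαβ⟩
      map_add' := fun _ _ => rfl
      map_smul' := fun _ _ => rfl }
  naturality _ _ := rfl

end ModFunctor

/-- `P° = {β ⊆ I : β ∩ α is finite for all α ∈ P}`. -/
def finPolar {I : Type u} (P : Set (Set I)) : Set (Set I) :=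
  {β | ∀ α ∈ P, (β ∩ α).Finite}

/-- `P ⊆ P°°`. -/
theorem subset_finPolar_finPolar {I : Type u} (P : Set (Set I)) : P ⊆ finPolar (finPolar P) :=
  fun α hα β hβ => by rw [Set.inter_comm]; exact hβ α hα

end

noncomputable section

namespace ModFunctor

variable {R : Type u} [CommRing R]

/-! Everything takes place in `𝓡^I`, where the functors involved are cut out by conditions on
supports. A compatible family in the limit over `P` glues to some `y ∈ S^I`, because `P` covers `I`
and is closed under unions; finiteness of its components says exactly that the support of `y` lies
in `P°`. Since `P°` is directed and stable under subsets, the colimit gives the same condition, and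
so does the intersection. Two monomorphisms with equal images are isomorphic over the target
(`Hom.exists_lift`).

For the dual, let `φ` be a form over `S` and let `β ∈ P°`. The value of `φ` at the generic vector
`(X_i)_{i ∈ β}` over `S[X_i : i ∈ I]` is a polynomial `F`. Every vector supported in `β` is a
specialization of the generic one, so by naturality `φ(x) = F(x)`. Only finitely many variables
occur in `F`, so `x` may be truncated to them, and linearity gives `φ(x) = ∑ φ(e_i) x_i` over a
finite set depending only on `φ` and `β` (`exists_finset_dualApply`). Hence the support of
`(φ(e_i))` meets each `β` in a finite set: it lies in `P°°`. Conversely, a family with support in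
`P°°` pairs with every `x`, so the dual is the limit over `P°`.

Reflexivity and the bipolar isomorphism then follow from `P°°° = P°`. -/

/-- A morphism `g` into `L` whose image agrees with that of a monomorphism `f` factors through `f`,
and the factorization is an isomorphism if `g` is a monomorphism. -/
theorem Hom.exists_lift {M : ModFunctor.{u, w} R} {N : ModFunctor.{u, w'} R}
    {L : ModFunctor.{u, w''} R} (f : Hom M L) (g : Hom N L) (hf : f.IsInjective)
    (hg : g.IsInjective) (h : f.range = g.range) :
    ∃ c : Hom N M, c.IsIso ∧ c.comp f = g := by
  have hr : ∀ S, LinearMap.range (f.app S) = LinearMap.range (g.app S) := fun S =>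
    congrFun (congrArg Subfunctor.carrier h) S
  let c : ∀ S : CommAlgCat.{u} R, N.obj S ≃ₗ[S] M.obj S := fun S =>
    (LinearEquiv.ofInjective (g.app S) (hg S)).trans
      ((LinearEquiv.ofEq _ _ (hr S).symm).trans (LinearEquiv.ofInjective (f.app S) (hf S)).symm)
  have hc : ∀ S n, f.app S (c S n) = g.app S n := fun S n => by
    have := LinearEquiv.apply_symm_apply (LinearEquiv.ofInjective (f.app S) (hf S))
      ((LinearEquiv.ofEq _ _ (hr S).symm) (LinearEquiv.ofInjective (g.app S) (hg S) n))
    exact congrArg Subtype.val this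
  refine ⟨⟨fun S => (c S).toLinearMap, fun {S T} k m => hf T ?_⟩, fun S => (c S).bijective, ?_⟩
  -- Naturality may be checked after the monomorphism `f`, where it becomes naturality of `f` and
  -- `g`.
  · change f.app T (M.map k (c S m)) = f.app T (c T (N.map k m))
    rw [← f.naturality, hc, hc, g.naturality]
  · cases g
    simp only [Hom.comp, Hom.mk.injEq]
    exact funext fun S => LinearMap.ext fun n => hc S n

/-! ### Morphisms out of a direct limit -/

section DirectLimit

variable {ι : Type w'} [Preorder ι] (F : ι → ModFunctor.{u, w} R)
  (f : ∀ i j, i ≤ j → Hom (F i) (F j)) {N : ModFunctor.{u, w''} R} (k : ∀ i, Hom (F i) N)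
  (hk : ∀ i j (h : i ≤ j) (S : CommAlgCat.{u} R) (x : (F i).obj S),
    (k j).app S ((f i j h).app S x) = (k i).app S x)

open Classical in
/-- The components of the morphism out of a direct limit given by a compatible family. -/
def dirLimDescApp (S : CommAlgCat.{u} R) : dirLimObj F f S →ₗ[S] N.obj S :=
  Module.DirectLimit.lift S ι (fun i => (F i).obj S) (fun i j h => (f i j h).app S)
    (fun i => (k i).app S) (fun i j h x => hk i j h S x)

theorem dirLimDescApp_of (S : CommAlgCat.{u} R) (i : ι) (x : (F i).obj S) :
    dirLimDescApp F f k hk S (dirLimOf F f S i x) = (k i).app S x := by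
  classical
  exact Module.DirectLimit.lift_of (fun i => (k i).app S) (fun i j h x => hk i j h S x) x

/-- The morphism out of a direct limit given by a compatible family. -/
def dirLimDesc : Hom (dirLim F f) N where
  app S := dirLimDescApp F f k hk S
  naturality {S T} g m := by
    refine DFunLike.congr_fun (dirLim_addHom_ext F f S
      (p := (N.map g).comp (dirLimDescApp F f k hk S).toAddMonoidHom)
      (q := (dirLimDescApp F f k hk T).toAddMonoidHom.comp (dirLimMap F f g)) fun i x => ?_) m
    change N.map g (dirLimDescApp F f k hk S (dirLimOf F f S i x)) =
      dirLimDescApp F f k hk T (dirLimMap F f g (dirLimOf F f S i x))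
    rw [dirLimMap_of, dirLimDescApp_of, dirLimDescApp_of, (k i).naturality]

theorem dirLimDesc_of {S : CommAlgCat.{u} R} (i : ι) (x : (F i).obj S) :
    (dirLimDesc F f k hk).app S ((dirLimIncl F f i).app S x) = (k i).app S x :=
  dirLimDescApp_of F f k hk S i x

theorem dirLim_exists_of [Nonempty ι] [IsDirectedOrder ι] {S : CommAlgCat.{u} R}
    (z : (dirLim F f).obj S) : ∃ i x, (dirLimIncl F f i).app S x = z := by
  classical
  exact Module.DirectLimit.exists_of (R := S) (G := fun i => (F i).obj S)
    (f := fun i j h => (f i j h).app S) z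

theorem dirLimDesc_isInjective [IsDirectedOrder ι] (h : ∀ i, (k i).IsInjective) :
    (dirLimDesc F f k hk).IsInjective := by
  classical
  exact fun S => Module.DirectLimit.lift_injective (fun i => (k i).app S)
    (fun i j h x => hk i j h S x) fun i => h i S

end DirectLimit

/-! ### Elements of the dual -/

section Dual

variable {M : ModFunctor.{u, w} R} {N : ModFunctor.{u, w'} R} {S T U : CommAlgCat.{u} R}

theorem dual_ext {φ ψ : M.dual.obj S}
    (h : ∀ (T : CommAlgCat.{u} R) (j : S ⟶ T) (m : M.obj T),
      M.dualApply φ j m = M.dualApply ψ j m) : φ = ψ :=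
  Subtype.ext (funext fun T => funext fun j => LinearMap.ext fun m => h T j m)

/-- `φ ∈ M^*(S)` as a linear form on `M(T)`, for an `S`-algebra `T`. -/
def dualLinear (φ : M.dual.obj S) (j : S ⟶ T) : M.obj T →ₗ[T] T :=
  (φ : homOver M (base R) S).1 T j

theorem dualLinear_apply (φ : M.dual.obj S) (j : S ⟶ T) (m : M.obj T) :
    dualLinear φ j m = M.dualApply φ j m := rfl

/-- Naturality of a form over `S`: its value at an element determines its values at all
specializations of that element over `S`. -/
theorem hom_dualApply (φ : M.dual.obj S) (j : S ⟶ T) (g : T ⟶ U) (m : M.obj T) :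
    g.hom (M.dualApply φ j m) = M.dualApply φ (j ≫ g) (M.map g m) :=
  (φ : homOver M (base R) S).2 T U j g m

theorem dualApply_smul (s : S) (φ : M.dual.obj S) (j : S ⟶ T) (m : M.obj T) :
    M.dualApply (s • φ) j m = j.hom s * M.dualApply φ j m := rfl

/-- The composite of `f : M → N` with an element of `N^*(S)`. -/
def dualPrecomp (f : Hom M N) (φ : N.dual.obj S) : M.dual.obj S :=
  (⟨fun T j => (dualLinear φ j).comp (f.app T), fun T T' j g m => by
    change g.hom (N.dualApply φ j (f.app T m)) = N.dualApply φ (j ≫ g) (f.app T' (M.map g m))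
    rw [hom_dualApply, f.naturality]⟩ : homOver M (base R) S)

theorem dualApply_dualPrecomp (f : Hom M N) (φ : N.dual.obj S) (j : S ⟶ T) (m : M.obj T) :
    M.dualApply (dualPrecomp f φ) j m = N.dualApply φ j (f.app T m) := rfl

theorem dualApply_bidualHom (m : M.obj S) (j : S ⟶ T) (φ : M.dual.obj T) :
    M.dual.dualApply (M.bidualHom.app S m) j φ = M.dualApply φ (𝟙 T) (M.map j m) := rfl

end Dual

end ModFunctor

/-! ### The polar of a family of subsets -/

section Polar

variable {I : Type u} {P : Set (Set I)}

/-- With `sUnion_finPolar`, this shows that `P°` satisfies the two hypotheses imposed on `P`, so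
that the results on limits over `P` also apply to `P°` and `P°°`. -/
theorem union_mem_finPolar (P : Set (Set I)) :
    ∀ β ∈ finPolar P, ∀ β' ∈ finPolar P, β ∪ β' ∈ finPolar P := fun β h β' h' α hα => by
  rw [Set.union_inter_distrib_right]
  exact (h α hα).union (h' α hα)

theorem mem_finPolar_of_subset {β β' : Set I} (h : β ∈ finPolar P) (h' : β' ⊆ β) :
    β' ∈ finPolar P := fun α hα => (h α hα).subset (Set.inter_subset_inter_left _ h')

theorem mem_finPolar_of_finite {β : Set I} (h : β.Finite) : β ∈ finPolar P :=
  fun _ _ => h.inter_of_left _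

theorem sUnion_finPolar (P : Set (Set I)) : ⋃₀ finPolar P = Set.univ :=
  Set.eq_univ_of_forall fun i =>
    ⟨{i}, mem_finPolar_of_finite (Set.finite_singleton i), Set.mem_singleton i⟩

/-- The relation "finite intersection" is symmetric, so polarity is an antitone Galois connection
with itself, and three applications reduce to one. -/
theorem finPolar_finPolar_finPolar (P : Set (Set I)) :
    finPolar (finPolar (finPolar P)) = finPolar P :=
  Set.Subset.antisymm (fun _ hβ α hα => hβ α (subset_finPolar_finPolar P hα))
    (subset_finPolar_finPolar _)

end Polar

namespace ModFunctor

variable {R : Type u} [CommRing R] {I : Type u} {P : Set (Set I)}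

/-! ### The limit as a subfunctor of `𝓡^I` -/

section Limit

/-- Both entries agree with the entry of the component indexed by `α ∪ α'`. -/
theorem limSumProj_apply_eq (hP : ∀ α ∈ P, ∀ α' ∈ P, α ∪ α' ∈ P) {S : CommAlgCat.{u} R}
    (x : (limSum R P).obj S) (α α' : P) {i : I} (h : i ∈ α.1) (h' : i ∈ α'.1) :
    sumCoe ((limSumProj R P α).app S x) ⟨i, h⟩ = sumCoe ((limSumProj R P α').app S x) ⟨i, h'⟩ := by
  let γ : P := ⟨α.1 ∪ α'.1, hP _ α.2 _ α'.2⟩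
  have e := x.2 α γ Set.subset_union_left
  have e' := x.2 α' γ Set.subset_union_right
  exact (DFunLike.congr_fun (F := α.1 →₀ S) e ⟨i, h⟩).symm.trans
    (DFunLike.congr_fun (F := α'.1 →₀ S) e' ⟨i, h'⟩)

/-- The morphism `lim_{α ∈ P} 𝓡^(α) → 𝓡^I`, for a covering `P` of `I`. -/
def limSumToPow (R : Type u) [CommRing R] (hI : ⋃₀ P = Set.univ) :
    Hom (limSum R P) (pow R I) :=
  -- The `i`-th coordinate is read off in an arbitrarily chosen member of `P` containing `i`;
  -- `coord_eq` removes the dependence on this choice.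
  have h (i : I) : ∃ α ∈ P, i ∈ α := by
    rw [← Set.mem_sUnion, hI]; trivial
  { app S :=
      { toFun := fun x i => sumCoe ((limSumProj R P ⟨(h i).choose, (h i).choose_spec.1⟩).app S x)
          ⟨i, (h i).choose_spec.2⟩
        map_add' := fun _ _ => rfl
        map_smul' := fun _ _ => rfl }
    naturality := fun _ _ => rfl }

/-- The family of coordinates of an element of the limit. -/
def coord (hI : ⋃₀ P = Set.univ) {S : CommAlgCat.{u} R} (x : (limSum R P).obj S) : I → S :=
  powCoe ((limSumToPow R hI).app S x)

theorem coord_map (hI : ⋃₀ P = Set.univ) {S T : CommAlgCat.{u} R} (g : S ⟶ T)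
    (x : (limSum R P).obj S) (i : I) :
    coord hI ((limSum R P).map g x) i = g.hom (coord hI x i) := rfl

theorem coord_add (hI : ⋃₀ P = Set.univ) {S : CommAlgCat.{u} R}
    (x y : (limSum R P).obj S) (i : I) : coord hI (x + y) i = coord hI x i + coord hI y i := rfl

theorem coord_smul (hI : ⋃₀ P = Set.univ) {S : CommAlgCat.{u} R} (s : S)
    (x : (limSum R P).obj S) (i : I) : coord hI (s • x) i = s * coord hI x i := rfl

theorem coord_eq (hP : ∀ α ∈ P, ∀ α' ∈ P, α ∪ α' ∈ P) (hI : ⋃₀ P = Set.univ)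
    {S : CommAlgCat.{u} R} (x : (limSum R P).obj S) (α : P) (i : α.1) :
    coord hI x i = sumCoe ((limSumProj R P α).app S x) i :=
  limSumProj_apply_eq hP x _ _ _ _

theorem coord_injective (hP : ∀ α ∈ P, ∀ α' ∈ P, α ∪ α' ∈ P) (hI : ⋃₀ P = Set.univ)
    {S : CommAlgCat.{u} R} {x y : (limSum R P).obj S} (h : ∀ i, coord hI x i = coord hI y i) :
    x = y :=
  Subtype.ext (funext fun α => Finsupp.ext fun i =>
    (coord_eq hP hI x α i).symm.trans ((h i).trans (coord_eq hP hI y α i)))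

/-- On each `α ∈ P` the coordinates are those of the finitely supported component at `α`. -/
theorem support_coord_mem (hP : ∀ α ∈ P, ∀ α' ∈ P, α ∪ α' ∈ P) (hI : ⋃₀ P = Set.univ)
    {S : CommAlgCat.{u} R} (x : (limSum R P).obj S) :
    Function.support (coord hI x) ∈ finPolar P := fun α hα => by
  refine ((sumCoe ((limSumProj R P ⟨α, hα⟩).app S x)).hasFiniteSupport.image Subtype.val).subset ?_
  rintro i ⟨hi, hiα⟩
  refine ⟨⟨i, hiα⟩, ?_, rfl⟩
  rw [Function.mem_support] at hi ⊢
  rwa [coord_eq hP hI x ⟨α, hα⟩ ⟨i, hiα⟩] at hi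

/-- The element of the limit given by a family with support in `P°`. -/
def limSumMk {S : CommAlgCat.{u} R} (y : I → S) (hy : Function.support y ∈ finPolar P) :
    (limSum R P).obj S :=
  (⟨fun α => (Finsupp.ofSupportFinite (fun i : α.1 => y i) (by
      refine Set.Finite.of_finite_image ((hy α.1 α.2).subset ?_) Subtype.val_injective.injOn
      rintro _ ⟨i, hi, rfl⟩
      exact ⟨hi, i.2⟩) : α.1 →₀ S), fun _ _ _ => Finsupp.ext fun _ => rfl⟩ :
    invLimObj (fun α : P => sum R α.1) (fun _ _ h => sumRestrict R h) S)

theorem coord_limSumMk (hI : ⋃₀ P = Set.univ) {S : CommAlgCat.{u} R} (y : I → S)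
    (hy : Function.support y ∈ finPolar P) (i : I) : coord hI (limSumMk (R := R) y hy) i = y i :=
  rfl

theorem limSumToPow_isInjective (hP : ∀ α ∈ P, ∀ α' ∈ P, α ∪ α' ∈ P) (hI : ⋃₀ P = Set.univ) :
    (limSumToPow R hI).IsInjective :=
  fun _ _ _ h => coord_injective hP hI fun i => congrFun h i

theorem mem_range_limSumToPow (hP : ∀ α ∈ P, ∀ α' ∈ P, α ∪ α' ∈ P) (hI : ⋃₀ P = Set.univ)
    {S : CommAlgCat.{u} R} (y : (pow R I).obj S) :
    y ∈ (limSumToPow R hI).range.carrier S ↔ Function.support (powCoe y) ∈ finPolar P := by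
  constructor
  · rintro ⟨x, rfl⟩
    exact support_coord_mem hP hI x
  · exact fun hy => ⟨limSumMk (powCoe y) hy, rfl⟩

end Limit

/-! ### The colimit as a subfunctor of `𝓡^I` -/

section Colimit

theorem powExtend_comp_powExtend {S : CommAlgCat.{u} R} {β β' : Set I} (h : β ⊆ β')
    (x : (pow R β).obj S) :
    (powExtend R (Subtype.val : β' → I) Subtype.val_injective).app S
      ((powExtend R (Set.inclusion h) (Set.inclusion_injective h)).app S x) =
    (powExtend R (Subtype.val : β → I) Subtype.val_injective).app S x := by
  -- For plain functions the claim is checked on the three regions `β`, `β' \ β` and the complement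
  -- of `β'`.
  have key (y : β → S) : Function.extend (Subtype.val : β' → I)
      (Function.extend (Set.inclusion h) y 0) 0 = Function.extend Subtype.val y 0 := by
    funext i
    by_cases hi : i ∈ β
    · have e : Function.extend (Subtype.val : β → I) y 0 i = y ⟨i, hi⟩ :=
        Subtype.val_injective.extend_apply y 0 ⟨i, hi⟩
      have e' := Subtype.val_injective.extend_apply
        (Function.extend (Set.inclusion h) y 0) (0 : I → S) ⟨i, h hi⟩
      rw [e]
      exact e'.trans ((Set.inclusion_injective h).extend_apply y 0 ⟨i, hi⟩)
    · rw [Function.extend_apply' y _ _ (by rintro ⟨a, rfl⟩; exact hi a.2)]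
      by_cases hi' : i ∈ β'
      · have e' := Subtype.val_injective.extend_apply
          (Function.extend (Set.inclusion h) y 0) (0 : I → S) ⟨i, hi'⟩
        refine e'.trans (Function.extend_apply' y _ _ ?_)
        rintro ⟨a, ha⟩
        have hai : a.1 = i := congrArg Subtype.val ha
        exact hi (hai ▸ a.2)
      · exact Function.extend_apply' _ _ _ (by rintro ⟨a, rfl⟩; exact hi' a.2)
  exact key x

/-- The morphism `colim_{β ∈ Q} 𝓡^β → 𝓡^I` given by the extensions by zero. -/
def colimPowToPow (R : Type u) [CommRing R] (Q : Set (Set I)) : Hom (colimPow R Q) (pow R I) :=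
  dirLimDesc _ _ (fun β : Q => powExtend R (Subtype.val : β.1 → I) Subtype.val_injective)
    (fun _ _ h _ x => powExtend_comp_powExtend h x)

theorem colimPowToPow_incl (Q : Set (Set I)) (β : Q) {S : CommAlgCat.{u} R}
    (x : (pow R β.1).obj S) :
    (colimPowToPow R Q).app S ((colimPowIncl R Q β).app S x) =
      (powExtend R (Subtype.val : β.1 → I) Subtype.val_injective).app S x :=
  dirLimDesc_of (fun β : Q => pow R β.1)
    (fun _ _ h => powExtend R (Set.inclusion h) (Set.inclusion_injective h))
    (fun β : Q => powExtend R (Subtype.val : β.1 → I) Subtype.val_injective)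
    (fun _ _ h _ x => powExtend_comp_powExtend h x) β x

theorem colimPowIncl_comp_colimPowToPow (Q : Set (Set I)) (β : Q) :
    (colimPowIncl R Q β).comp (colimPowToPow R Q) =
      powExtend R (Subtype.val : β.1 → I) Subtype.val_injective := by
  have h : ((colimPowIncl R Q β).comp (colimPowToPow R Q)).app =
      (powExtend R (Subtype.val : β.1 → I) Subtype.val_injective).app :=
    funext fun S => LinearMap.ext fun x => colimPowToPow_incl Q β x
  -- A morphism is its components together with a proof, so equality of components suffices once
  -- both sides are destructured.
  cases hf : (colimPowIncl R Q β).comp (colimPowToPow R Q)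
  cases hg : powExtend R (Subtype.val : β.1 → I) Subtype.val_injective
  rw [hf, hg] at h
  simpa using h

theorem powExtend_injective {α β : Type u} (e : α → β) (he : Function.Injective e)
    (S : CommAlgCat.{u} R) : Function.Injective ((powExtend R e he).app S) := by
  intro x y h
  have h' : Function.extend e (powCoe x) 0 = Function.extend e (powCoe y) 0 := h
  refine funext fun i => ?_
  have := congrFun h' (e i)
  rwa [he.extend_apply, he.extend_apply] at this

variable (P) in
theorem isDirected_finPolar : IsDirectedOrder (finPolar P) :=
  ⟨fun β β' => ⟨⟨β.1 ∪ β'.1, union_mem_finPolar P _ β.2 _ β'.2⟩, Set.subset_union_left,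
    Set.subset_union_right⟩⟩

variable (P) in
theorem nonempty_finPolar : Nonempty (finPolar P) :=
  ⟨⟨∅, mem_finPolar_of_finite Set.finite_empty⟩⟩

variable (P) in
theorem exists_colimPowIncl {S : CommAlgCat.{u} R} (z : (colimPow R (finPolar P)).obj S) :
    ∃ β x, (colimPowIncl R (finPolar P) β).app S x = z := by
  have := isDirected_finPolar P
  have := nonempty_finPolar P
  exact dirLim_exists_of _ _ z

variable (P) in
theorem colimPowToPow_isInjective : (colimPowToPow R (finPolar P)).IsInjective := by
  have := isDirected_finPolar P
  exact dirLimDesc_isInjective _ _ _ _ fun β S => powExtend_injective _ _ S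

theorem mem_range_powExtend {S : CommAlgCat.{u} R} (β : Set I) (y : (pow R I).obj S) :
    y ∈ (powExtend R (Subtype.val : β → I) Subtype.val_injective).range.carrier S ↔
      Function.support (powCoe y) ⊆ β := by
  constructor
  · rintro ⟨x, rfl⟩ i hi
    by_contra h
    exact hi (Function.extend_apply' (f := (Subtype.val : β → I)) (powCoe x) (0 : I → S) i
      (by rintro ⟨a, rfl⟩; exact h a.2))
  · intro h
    refine ⟨fun i : β => powCoe y i, funext fun i => ?_⟩
    change Function.extend (Subtype.val : β → I) (fun i : β => powCoe y i) 0 i = powCoe y i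
    by_cases hi : i ∈ β
    · exact Subtype.val_injective.extend_apply (fun i : β => powCoe y i) 0 ⟨i, hi⟩
    · rw [Function.extend_apply' _ _ _ (by rintro ⟨a, rfl⟩; exact hi a.2)]
      by_contra h'
      exact hi (h (Ne.symm h'))

/-- By directedness an element of the colimit comes from a single `β ∈ P°`, and `P°` is stable under
subsets. Conversely, the support of `y` itself serves as the index. -/
theorem mem_range_colimPowToPow {S : CommAlgCat.{u} R} (y : (pow R I).obj S) :
    y ∈ (colimPowToPow R (finPolar P)).range.carrier S ↔
      Function.support (powCoe y) ∈ finPolar P := by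
  constructor
  · rintro ⟨z, rfl⟩
    obtain ⟨β, x, rfl⟩ := exists_colimPowIncl P z
    rw [colimPowToPow_incl]
    exact mem_finPolar_of_subset β.2 ((mem_range_powExtend _ _).1 ⟨x, rfl⟩)
  · intro h
    obtain ⟨x, hx⟩ := (mem_range_powExtend _ y).2 subset_rfl
    exact ⟨(colimPowIncl R (finPolar P) ⟨_, h⟩).app S x, (colimPowToPow_incl _ ⟨_, h⟩ x).trans hx⟩

end Colimit

/-- The two summands live on complementary sets, so the condition is only on `α`, where the
restriction of `y` must have finite support. -/
theorem mem_range_mixedIncl {S : CommAlgCat.{u} R} (α : Set I) (y : (pow R I).obj S) :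
    y ∈ (mixedIncl R α).range.carrier S ↔ (Function.support (powCoe y) ∩ α).Finite := by
  have key (x : α →₀ S) (z : ↥αᶜ → S) (i : α) :
      Function.extend (Subtype.val : α → I) x 0 i + Function.extend (Subtype.val : ↥αᶜ → I) z 0 i
        = x i := by
    rw [Subtype.val_injective.extend_apply, Function.extend_apply' _ _ _
      (by rintro ⟨a, ha⟩; exact a.2 (ha ▸ i.2)), Pi.zero_apply, add_zero]
  have key' (x : α →₀ S) (z : ↥αᶜ → S) (i : ↥αᶜ) :
      Function.extend (Subtype.val : α → I) x 0 i + Function.extend (Subtype.val : ↥αᶜ → I) z 0 i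
        = z i := by
    rw [Subtype.val_injective.extend_apply, Function.extend_apply' _ _ _
      (by rintro ⟨a, ha⟩; exact i.2 (ha ▸ a.2)), Pi.zero_apply, zero_add]
  constructor
  · rintro ⟨⟨x, z⟩, rfl⟩
    refine ((sumCoe x).hasFiniteSupport.image Subtype.val).subset ?_
    rintro i ⟨hi, hiα⟩
    refine ⟨⟨i, hiα⟩, ?_, rfl⟩
    rw [Function.mem_support, ← key (sumCoe x) (powCoe z)]
    exact hi
  · intro h
    let x : α →₀ S := Finsupp.ofSupportFinite (fun i : α => powCoe y i) (by
      refine Set.Finite.of_finite_image (h.subset ?_) Subtype.val_injective.injOn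
      rintro _ ⟨i, hi, rfl⟩
      exact ⟨hi, i.2⟩)
    let z : ↥αᶜ → S := fun i => powCoe y i
    refine ⟨(x, z), funext fun i => ?_⟩
    by_cases hi : i ∈ α
    · exact key x z ⟨i, hi⟩
    · exact key' x z ⟨i, hi⟩

/-! ### The dual of the limit -/

section DualLimit

open Classical in
/-- The `i`-th unit vector. -/
def unitVec (P : Set (Set I)) (S : CommAlgCat.{u} R) (i : I) : (limSum R P).obj S :=
  limSumMk (Pi.single i 1) (mem_finPolar_of_finite
    ((Set.finite_singleton i).subset Pi.support_single_subset))

theorem coord_unitVec_self (hI : ⋃₀ P = Set.univ) (S : CommAlgCat.{u} R) (i : I) :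
    coord hI (unitVec P S i) i = 1 := by
  classical
  rw [unitVec, coord_limSumMk, Pi.single_eq_same]

theorem coord_unitVec_of_ne (hI : ⋃₀ P = Set.univ) (S : CommAlgCat.{u} R) {i k : I}
    (h : k ≠ i) : coord hI (unitVec P S i) k = 0 := by
  classical
  rw [unitVec, coord_limSumMk, Pi.single_eq_of_ne h]

theorem map_unitVec {S T : CommAlgCat.{u} R} (g : S ⟶ T) (i : I) :
    (limSum R P).map g (unitVec P S i) = unitVec P T i := by
  classical
  refine Subtype.ext (funext fun α => Finsupp.ext fun k => ?_)
  change g.hom ((Pi.single i 1 : I → S) k) = (Pi.single i 1 : I → T) k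
  rcases eq_or_ne k.1 i with h | h
  · rw [h, Pi.single_eq_same, Pi.single_eq_same, map_one]
  · rw [Pi.single_eq_of_ne h, Pi.single_eq_of_ne h, map_zero]

/-- The morphism `S[X_i : i ∈ I] → T` over `S` with values `y`. -/
def evalHom {S T : CommAlgCat.{u} R} (j : S ⟶ T) (y : I → T) :
    CommAlgCat.of R (MvPolynomial I S) ⟶ T :=
  CommAlgCat.ofHom
    { MvPolynomial.eval₂Hom (j.hom : S →+* T) y with
      commutes' := fun r => by
        change MvPolynomial.eval₂ (j.hom : S →+* T) y (algebraMap R (MvPolynomial I S) r) = _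
        rw [MvPolynomial.algebraMap_apply, MvPolynomial.eval₂_C]
        exact j.hom.commutes r }

/-- The structure morphism `S → S[X_i : i ∈ I]`. -/
def constHom (I : Type u) (S : CommAlgCat.{u} R) : S ⟶ CommAlgCat.of R (MvPolynomial I S) :=
  CommAlgCat.ofHom (IsScalarTower.toAlgHom R S (MvPolynomial I S))

/-- Evaluation is a morphism of `S`-algebras to `(T, j)`, so forms over `S` are natural along it. -/
theorem constHom_comp_evalHom {S T : CommAlgCat.{u} R} (j : S ⟶ T) (y : I → T) :
    constHom I S ≫ evalHom j y = j := by
  refine CommAlgCat.hom_ext (AlgHom.ext fun s => ?_)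
  exact MvPolynomial.eval₂_C _ _ _

/-- The generic element of the limit with support in `β`. -/
def genericVec (S : CommAlgCat.{u} R) (β : finPolar P) :
    (limSum R P).obj (CommAlgCat.of R (MvPolynomial I S)) :=
  limSumMk (Set.indicator β.1 MvPolynomial.X)
    (mem_finPolar_of_subset β.2 Set.support_indicator_subset)

variable (hP : ∀ α ∈ P, ∀ α' ∈ P, α ∪ α' ∈ P) (hI : ⋃₀ P = Set.univ)

-- The substitution `X_i ↦ x_i` turns the generic vector into any given vector supported in `β`.
include hP in
theorem map_genericVec {S T : CommAlgCat.{u} R} (j : S ⟶ T) (β : finPolar P)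
    (x : (limSum R P).obj T) (hx : Function.support (coord hI x) ⊆ β.1) :
    (limSum R P).map (evalHom j (coord hI x)) (genericVec S β) = x := by
  refine coord_injective hP hI fun i => ?_
  rw [coord_map, genericVec, coord_limSumMk]
  by_cases hi : i ∈ β.1
  · rw [Set.indicator_of_mem hi]
    exact MvPolynomial.eval₂_X _ _ _
  · rw [Set.indicator_of_notMem hi, map_zero]
    by_contra h
    exact hi (hx (Ne.symm h))

include hP in
/-- On vectors supported in `β ∈ P°`, a linear form is determined by finitely many coordinates:
those whose variables occur in its value at the generic vector. -/
theorem exists_finset_dualApply {S : CommAlgCat.{u} R} (φ : (limSum R P).dual.obj S)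
    (β : finPolar P) : ∃ J : Finset I, ∀ (T : CommAlgCat.{u} R) (j : S ⟶ T)
      (x : (limSum R P).obj T), Function.support (coord hI x) ⊆ β.1 →
      (limSum R P).dualApply φ j x =
        ∑ i ∈ J, j.hom ((limSum R P).dualApply φ (𝟙 S) (unitVec P S i)) * coord hI x i := by
  classical
  -- A single polynomial encodes `φ` on all vectors supported in `β`, over all `S`-algebras at once.
  let F : MvPolynomial I S := (limSum R P).dualApply φ (constHom I S) (genericVec S β)
  have hF (T : CommAlgCat.{u} R) (j : S ⟶ T) (x : (limSum R P).obj T)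
      (hx : Function.support (coord hI x) ⊆ β.1) :
      (limSum R P).dualApply φ j x = MvPolynomial.eval₂ (j.hom : S →+* T) (coord hI x) F := by
    have h := hom_dualApply φ (constHom I S) (evalHom j (coord hI x)) (genericVec S β)
    rw [constHom_comp_evalHom, map_genericVec hP hI j β x hx] at h
    exact h.symm
  refine ⟨F.vars, fun T j x hx => ?_⟩
  -- The truncation of `x` to the variables of `F`: evaluating `F` does not distinguish it from `x`,
  -- and it is a finite combination of unit vectors, so linearity computes `φ(y)`.
  let y : (limSum R P).obj T := ∑ i ∈ F.vars, coord hI x i • unitVec P T i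
  have hy (i : I) : coord hI y i = if i ∈ F.vars then coord hI x i else 0 := by
    have h (s : Finset I) : coord hI (∑ i ∈ s, coord hI x i • unitVec P T i) i =
        if i ∈ s then coord hI x i else 0 := by
      induction s using Finset.induction_on with
      | empty => rfl
      | insert k s hk ih =>
        rw [Finset.sum_insert hk, coord_add, ih, coord_smul]
        rcases eq_or_ne i k with rfl | hik
        · simp [hk, coord_unitVec_self]
        · simp [hik, coord_unitVec_of_ne hI T hik]
    exact h _
  have hyβ : Function.support (coord hI y) ⊆ β.1 := fun i hi => hx fun h => hi (by
    rw [hy]; split_ifs; exacts [h, rfl])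
  have hxy : (limSum R P).dualApply φ j x = (limSum R P).dualApply φ j y := by
    rw [hF T j x hx, hF T j y hyβ]
    refine MvPolynomial.eval₂Hom_congr' rfl (fun i hi _ => ?_) rfl
    rw [hy, if_pos hi]
  rw [hxy, ← dualLinear_apply, map_sum]
  refine Finset.sum_congr rfl fun i _ => ?_
  rw [_root_.map_smul, dualLinear_apply, hom_dualApply, map_unitVec, Category.id_comp, smul_eq_mul,
    mul_comm]

/-- The morphism `φ ↦ (φ(e_i))_i`. -/
def dualToPow (R : Type u) [CommRing R] (P : Set (Set I)) :
    Hom (limSum R P).dual (pow R I) where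
  app S :=
    { toFun := fun φ i => (limSum R P).dualApply φ (𝟙 S) (unitVec P S i)
      map_add' := fun _ _ => rfl
      map_smul' := fun s φ => funext fun i => by
        rw [dualApply_smul]; rfl }
  naturality {S T} g φ := funext fun i => by
    change g.hom ((limSum R P).dualApply φ (𝟙 S) (unitVec P S i)) =
      (limSum R P).dualApply φ (g ≫ 𝟙 T) (unitVec P T i)
    rw [hom_dualApply, map_unitVec, Category.id_comp, Category.comp_id]

theorem dualToPow_apply {S : CommAlgCat.{u} R} (φ : (limSum R P).dual.obj S) (i : I) :
    powCoe ((dualToPow R P).app S φ) i = (limSum R P).dualApply φ (𝟙 S) (unitVec P S i) := rfl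

-- For `k ∈ β` outside the finite set `J` attached to `β`, the formula for `φ` at `e_k` has only
-- zero terms, so `φ(e_k) = 0`.
include hP hI in
theorem support_dualToPow_mem {S : CommAlgCat.{u} R} (φ : (limSum R P).dual.obj S) :
    Function.support (powCoe ((dualToPow R P).app S φ)) ∈ finPolar (finPolar P) := by
  classical
  intro β hβ
  obtain ⟨J, hJ⟩ := exists_finset_dualApply hP hI φ ⟨β, hβ⟩
  refine J.finite_toSet.subset ?_
  rintro k ⟨hk, hkβ⟩
  by_contra hkJ
  refine hk ?_
  rw [dualToPow_apply, hJ S (𝟙 S)]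
  · refine Finset.sum_eq_zero fun i hi => ?_
    rw [coord_unitVec_of_ne hI S (i := k) (k := i) (fun h => hkJ (h ▸ hi)), mul_zero]
  · exact Pi.support_single_subset.trans (Set.singleton_subset_iff.2 hkβ)

include hP in
theorem dualApply_eq_finsum {S T : CommAlgCat.{u} R} (φ : (limSum R P).dual.obj S) (j : S ⟶ T)
    (x : (limSum R P).obj T) :
    (limSum R P).dualApply φ j x =
      ∑ᶠ i, j.hom (powCoe ((dualToPow R P).app S φ) i) * coord hI x i := by
  classical
  -- Taking `β` to be the support of `x` makes every `e_k` with `x_k ≠ 0` supported in `β`; the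
  -- formula at `e_k` then gives `φ(e_k) = 0` for `k ∉ J`, so `J` contains all nonzero terms.
  obtain ⟨J, hJ⟩ := exists_finset_dualApply hP hI φ ⟨_, support_coord_mem hP hI x⟩
  rw [hJ T j x subset_rfl]
  refine (finsum_eq_sum_of_support_subset _ fun k hk => ?_).symm
  by_contra hkJ
  have hkx : coord hI x k ≠ 0 := right_ne_zero_of_mul hk
  refine left_ne_zero_of_mul hk ?_
  rw [hJ S (𝟙 S), Finset.sum_eq_zero, map_zero]
  · intro i hi
    rw [coord_unitVec_of_ne hI S (i := k) (k := i) (fun h => hkJ (h ▸ hi)), mul_zero]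
  · exact Pi.support_single_subset.trans (Set.singleton_subset_iff.2 hkx)

include hP hI in
theorem dualToPow_isInjective : (dualToPow R P).IsInjective := fun S φ ψ h =>
  dual_ext fun T j x => by
    rw [dualApply_eq_finsum hP hI, dualApply_eq_finsum hP hI, h]

-- The supports lie in `P°°` and in `P°`, so they meet in a finite set. Thus the `finsum` of the
-- pairing is a genuine sum and not the default value `0`.
include hP in
theorem finite_support_pairing {S T : CommAlgCat.{u} R} (j : S ⟶ T)
    (v : (limSum R (finPolar P)).obj S) (x : (limSum R P).obj T) :
    (Function.support fun i => j.hom (coord (sUnion_finPolar P) v i) * coord hI x i).Finite := by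
  refine ((support_coord_mem (union_mem_finPolar P) (sUnion_finPolar P) v) _
    (support_coord_mem hP hI x)).subset fun i hi => ⟨fun h => hi ?_, fun h => hi ?_⟩
  · change j.hom _ * _ = 0
    rw [h, map_zero, zero_mul]
  · change j.hom _ * _ = 0
    rw [h, mul_zero]

/-- The linear form `x ↦ ∑ i, v i * x i` on the limit given by `v ∈ lim_{β ∈ P°} 𝓡^(β)`. -/
def pairing : Hom (limSum R (finPolar P)) (limSum R P).dual where
  app S :=
    { toFun := fun v => (⟨fun T j =>
        { toFun := fun x => (∑ᶠ i, j.hom (coord (sUnion_finPolar P) v i) * coord hI x i : T)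
          map_add' := fun x y => by
            refine Eq.trans ?_ (finsum_add_distrib (finite_support_pairing hP hI j v x)
              (finite_support_pairing hP hI j v y))
            exact finsum_congr fun i => by rw [coord_add, mul_add]; rfl
          map_smul' := fun t x => by
            refine Eq.trans ?_ (mul_finsum' _ t (finite_support_pairing hP hI j v x)).symm
            exact finsum_congr fun i => by rw [coord_smul, mul_left_comm] },
        fun T T' j g x => by
          change g.hom (∑ᶠ i, j.hom (coord (sUnion_finPolar P) v i) * coord hI x i) =
            ∑ᶠ i, (j ≫ g).hom (coord (sUnion_finPolar P) v i) *
              coord hI ((limSum R P).map g x) i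
          refine (AddMonoidHom.map_finsum (g.hom : T →+ T')
            (finite_support_pairing hP hI j v x)).trans (finsum_congr fun i => ?_)
          rw [coord_map]
          exact map_mul g.hom _ _⟩ : homOver (limSum R P) (base R) S)
      map_add' := fun v v' => dual_ext fun T j x => by
        refine Eq.trans ?_ (finsum_add_distrib (finite_support_pairing hP hI j v x)
          (finite_support_pairing hP hI j v' x))
        exact finsum_congr fun i => by rw [coord_add, map_add, add_mul]
      map_smul' := fun s v => dual_ext fun T j x => by
        refine Eq.trans ?_ (mul_finsum' _ (j.hom s) (finite_support_pairing hP hI j v x)).symm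
        exact finsum_congr fun i => by rw [coord_smul, map_mul, mul_assoc] }
  naturality {S T} g v := rfl

theorem dualApply_pairing {S T : CommAlgCat.{u} R} (j : S ⟶ T)
    (v : (limSum R (finPolar P)).obj S) (x : (limSum R P).obj T) :
    (limSum R P).dualApply ((pairing hP hI).app S v) j x =
      ∑ᶠ i, j.hom (coord (sUnion_finPolar P) v i) * coord hI x i := rfl

/-- Pairing with `e_i` picks out the `i`-th coordinate. -/
theorem dualToPow_pairing {S : CommAlgCat.{u} R} (v : (limSum R (finPolar P)).obj S) :
    (dualToPow R P).app S ((pairing hP hI).app S v) =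
      (limSumToPow R (sUnion_finPolar P)).app S v := by
  classical
  refine funext fun i => ?_
  refine (dualApply_pairing hP hI (𝟙 S) v (unitVec P S i)).trans ?_
  rw [finsum_eq_single _ i]
  · rw [coord_unitVec_self, mul_one]
    rfl
  · intro k hk
    rw [coord_unitVec_of_ne _ _ hk, mul_zero]

-- Both images consist of the families with support in `P°°`: the pairing realizes all of them, and
-- `support_dualToPow_mem` excludes any other.
include hP hI in
theorem range_dualToPow :
    (limSumToPow R (sUnion_finPolar P)).range = (dualToPow R P).range := by
  refine Subfunctor.ext (funext fun S => Submodule.ext fun y => ?_)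
  constructor
  · rintro ⟨v, rfl⟩
    exact ⟨(pairing hP hI).app S v, dualToPow_pairing hP hI v⟩
  · rintro ⟨φ, rfl⟩
    rw [mem_range_limSumToPow (union_mem_finPolar P)]
    exact support_dualToPow_mem hP hI φ

/-- Terms outside `β` vanish with `x`, and on `β` the coordinates of `v` are those of its finitely
supported `β`-component. -/
theorem sum_limSumProj_eq_finsum {S T : CommAlgCat.{u} R} (j : S ⟶ T)
    (v : (limSum R (finPolar P)).obj S) (x : (limSum R P).obj T) (β : finPolar P)
    (hx : Function.support (coord hI x) ⊆ β.1) :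
    Finsupp.sum (sumCoe ((limSumProj R (finPolar P) β).app S v))
        (fun i s => j.hom s * coord hI x i) =
      ∑ᶠ i, j.hom (coord (sUnion_finPolar P) v i) * coord hI x i := by
  have h : ∑ᶠ i : β.1, j.hom (coord (sUnion_finPolar P) v i) * coord hI x i =
      Finsupp.sum (sumCoe ((limSumProj R (finPolar P) β).app S v))
        (fun i s => j.hom s * coord hI x i) := by
    simp_rw [coord_eq (union_mem_finPolar P) (sUnion_finPolar P) v β]
    refine finsum_eq_sum_of_support_subset _ fun i hi => ?_
    rw [Finset.mem_coe, Finsupp.mem_support_iff]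
    intro h
    refine hi ?_
    change j.hom _ * _ = 0
    rw [h, map_zero, zero_mul]
  rw [← h, finsum_set_coe_eq_finsum_mem β.1
    (f := fun i => j.hom (coord (sUnion_finPolar P) v i) * coord hI x i)]
  refine (finsum_mem_inter_support_eq' (M := T) _ β.1 Set.univ fun i hi =>
    ⟨fun _ => trivial, fun _ => ?_⟩).trans (finsum_mem_univ _)
  exact hx (right_ne_zero_of_mul hi)

end DualLimit

/-! ### Reflexivity and the bipolar family -/

section Bipolar

variable (hP : ∀ α ∈ P, ∀ α' ∈ P, α ∪ α' ∈ P) (hI : ⋃₀ P = Set.univ)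

include hP hI in
theorem limSumRestrict_isIso : (limSumRestrict R (subset_finPolar_finPolar P)).IsIso := by
  have hP' := union_mem_finPolar (finPolar P)
  have hI' := sUnion_finPolar (finPolar P)
  -- Forgetting components does not change coordinates, so both limits sit in `𝓡^I`, with supports
  -- in `P°°°` and in `P°`, which are equal.
  have hr (S : CommAlgCat.{u} R) (x : (limSum R (finPolar (finPolar P))).obj S) (i : I) :
      coord hI ((limSumRestrict R (subset_finPolar_finPolar P)).app S x) i = coord hI' x i := by
    obtain ⟨α, hα, hi⟩ : ∃ α ∈ P, i ∈ α := by
      rw [← Set.mem_sUnion, hI]; trivial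
    rw [coord_eq hP hI _ ⟨α, hα⟩ ⟨i, hi⟩,
      coord_eq hP' hI' x ⟨α, subset_finPolar_finPolar P hα⟩ ⟨i, hi⟩]
    rfl
  refine fun S => ⟨fun x y h => coord_injective hP' hI' fun i => ?_, fun x => ?_⟩
  · rw [← hr, ← hr, h]
  · have hx := support_coord_mem hP hI x
    rw [← finPolar_finPolar_finPolar] at hx
    refine ⟨limSumMk (coord hI x) hx, coord_injective hP hI fun i => ?_⟩
    rw [hr, coord_limSumMk]

include hP hI in
theorem limSum_isReflexive : (limSum R P).IsReflexive := by
  have hP' := union_mem_finPolar P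
  have hI' := sUnion_finPolar P
  refine fun S => ⟨fun x y h => coord_injective hP hI fun i => ?_, fun Φ => ?_⟩
  -- The coordinates of `z` are recovered by evaluating the bidual element at the coordinate forms.
  · have key (z : (limSum R P).obj S) : (limSum R P).dual.dualApply
        ((limSum R P).bidualHom.app S z) (𝟙 S) ((pairing hP hI).app S (unitVec _ S i)) =
        coord hI z i := by
      classical
      rw [dualApply_bidualHom, dualApply_pairing, finsum_eq_single _ i]
      · rw [coord_unitVec_self, map_one, one_mul, (limSum R P).map_id]
      · intro k hk
        rw [coord_unitVec_of_ne _ _ hk, map_zero, zero_mul]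
    rw [← key x, ← key y, h]
  -- Pulled back along the pairing, `Φ` becomes a form on the limit over `P°`. Its coefficients have
  -- support in `P°°° = P°`, hence define the required preimage of `Φ`.
  · let Ψ : (limSum R (finPolar P)).dual.obj S := dualPrecomp (pairing hP hI) Φ
    have hΨ := support_dualToPow_mem hP' hI' Ψ
    rw [finPolar_finPolar_finPolar] at hΨ
    refine ⟨limSumMk _ hΨ, dual_ext fun T j φ => ?_⟩
    -- Every form `φ` is the pairing with some `v`, so it is enough to compare values at such forms.
    obtain ⟨v, hv⟩ : (dualToPow R P).app T φ ∈ (limSumToPow R hI').range.carrier T := by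
      rw [range_dualToPow hP hI]
      exact ⟨φ, rfl⟩
    have hφ : (pairing hP hI).app T v = φ :=
      dualToPow_isInjective hP hI T ((dualToPow_pairing hP hI v).trans hv)
    rw [← hφ, dualApply_bidualHom, dualApply_pairing, ← dualApply_dualPrecomp,
      dualApply_eq_finsum hP' hI']
    refine finsum_congr fun i => ?_
    rw [coord_map, coord_limSumMk, CommAlgCat.hom_id, mul_comm]
    rfl

end Bipolar

end ModFunctor

end

/-! ### Assembly of the theorem -/

open ModFunctor in
theorem mainTheorem3 {R I : Type u} [CommRing R] (P : Set (Set I))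
    (hP : ∀ α ∈ P, ∀ α' ∈ P, α ∪ α' ∈ P) (hI : ⋃₀ P = Set.univ) :
    ∃ (a : Hom (limSum R P) (pow R I)) (b : Hom (colimPow R (finPolar P)) (pow R I)),
      -- `a` and `b` are the canonical morphisms to `𝓡^I`
      (∀ (S : CommAlgCat.{u} R) (x : (limSum R P).obj S) (α : P) (i : α.1),
        powCoe (a.app S x) i =
          sumCoe ((limSumProj R P α).app S x) i) ∧
      (∀ β : finPolar P, (colimPowIncl R (finPolar P) β).comp b =
        powExtend R (Subtype.val : β.1 → I) Subtype.val_injective) ∧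
      -- they identify the limit and the colimit with one and the same subfunctor of `𝓡^I`
      a.IsInjective ∧ b.IsInjective ∧
      a.range = b.range ∧
      (∃ c : Hom (colimPow R (finPolar P)) (limSum R P), c.IsIso ∧ c.comp a = b) ∧
      a.range = Subfunctor.iInter (fun α : P => (mixedIncl R α.1).range) ∧
      -- the dual, through the pairing `⟨w, x⟩ = ∑ i, w i * x i`
      (∃ d : Hom (limSum R P).dual (limSum R (finPolar P)), d.IsIso ∧
        ∀ (S T : CommAlgCat.{u} R) (j : S ⟶ T) (φ : (limSum R P).dual.obj S)
          (x : (limSum R P).obj T) (β : finPolar P),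
          (∀ i, powCoe (a.app T x) i ≠ 0 → i ∈ β.1) →
          (limSum R P).dualApply φ j x =
            Finsupp.sum (sumCoe ((limSumProj R (finPolar P) β).app S (d.app S φ)))
              (fun i s => j.hom s * powCoe (a.app T x) i)) ∧
      -- reflexivity and the bipolar family
      (limSum R P).IsReflexive ∧
      (limSumRestrict R (subset_finPolar_finPolar P)).IsIso := by
  have hab : (limSumToPow R hI).range = (colimPowToPow R (finPolar P)).range :=
    Subfunctor.ext (funext fun S => Submodule.ext fun y =>
      (mem_range_limSumToPow hP hI y).trans (mem_range_colimPowToPow y).symm)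
  have ha := limSumToPow_isInjective (R := R) hP hI
  have hb := colimPowToPow_isInjective (R := R) P
  refine ⟨limSumToPow R hI, colimPowToPow R (finPolar P), fun S x α i => coord_eq hP hI x α i,
    fun β => colimPowIncl_comp_colimPowToPow _ β, ha, hb, hab, Hom.exists_lift _ _ ha hb hab,
    ?_, ?_, limSum_isReflexive hP hI, limSumRestrict_isIso hP hI⟩
  · refine Subfunctor.ext (funext fun S => Submodule.ext fun y => ?_)
    rw [mem_range_limSumToPow hP hI]
    change _ ↔ y ∈ ⨅ α : P, (mixedIncl R α.1).range.carrier S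
    simp_rw [Submodule.mem_iInf, mem_range_mixedIncl]
    exact ⟨fun h α => h α.1 α.2, fun h α hα => h ⟨α, hα⟩⟩
  -- The dual and the limit over `P°` have the same image in `𝓡^I`; `hd'` says that the coordinates
  -- of `d φ` are the values `φ(e_i)`.
  · obtain ⟨d, hd, hd'⟩ := Hom.exists_lift _ _
      (limSumToPow_isInjective (union_mem_finPolar P) (sUnion_finPolar P))
      (dualToPow_isInjective hP hI) (range_dualToPow (R := R) hP hI)
    refine ⟨d, hd, fun S T j φ x β hx => ?_⟩
    refine (dualApply_eq_finsum hP hI φ j x).trans ?_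
    rw [← hd']
    exact (sum_limSumProj_eq_finsum hI j _ x β hx).symm
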